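/- Let $E$ be a real Banach lattice. For $S\subseteq E$ let $\mathrm{sol}(S)=\{x\in E:\ |x|\le |y| \text{ for some } y\in S\}$ be its solid hull. A net $(x_\alpha)$ in $E$ is uaw-convergent to $x\in E$, written $x_\alpha\overset{uaw}{\longrightarrow}x$, if $|x_\alpha-x|\wedge u\to 0$ weakly for every $u\ge 0$ in $E$. A norm bounded set $A\subseteq E$ is uaw-compact (respectively, relatively uaw-compact) if every net in $A$ has a subnet that is uaw-convergent to a point of $A$ (respectively, of $E$). A norm bounded set $S\subseteq E$ is L-weakly compact if $\|x_n\|\to 0$ for every disjoint sequence $(x_n)$ in $\mathrm{sol}(S)$. The space $E$ has the positive Schur property if every weakly null sequence of positive elements of $E$ is norm null. Then the following statements are equivalent: 1. $E$ has the positive Schur property. 2. Every relatively weakly compact subset of $E$ is L-weakly compact. 3. For every relatively weakly compact $S\subseteq E$ and every net $(x_\alpha)$ in $\mathrm{sol}(S)$ with $x_\alpha\overset{uaw}{\longrightarrow}0$, we have $\|x_\alpha\|\to 0$. 4. For every relatively weakly compact $S\subseteq E$ and every sequence $(x_n)$ in $\mathrm{sol}(S)$ with $x_n\overset{uaw}{\longrightarrow}0$,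 we have $\|x_n\|\to 0$. 5. For every relatively weakly compact $S\subseteq E$, every uaw-compact subset $A$ of $\mathrm{sol}(S)$ is norm compact. 6. For every relatively weakly compact $S\subseteq E$, every relatively uaw-compact subset $A$ of $\mathrm{sol}(S)$ is relatively norm compact. -/

import Mathlib

open Filter Topology

universe u v

/-!
A (real) Banach lattice is given by the Mathlib classes
`NormedAddCommGroup E`, `NormedSpace ℝ E`, `CompleteSpace E`, `Lattice E`, `IsOrderedAddMonoid E`,
`IsOrderedModule ℝ E` and `HasSolidNorm E` (that is, `|x| ≤ |y|` implies `‖x‖ ≤ ‖y‖`).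
The solid hull `sol(S) = {x | ∃ y ∈ S, |x| ≤ |y|}` is Mathlib's
`LatticeOrderedAddCommGroup.solidClosure S`, and the weak topology is that of `WeakSpace ℝ E`.
-/

namespace BanachLattice

/-- `x i` converges weakly to `a` along the filter `l` (for a net, `l = atTop`). -/
def WeakTendsto {E : Type*} [NormedAddCommGroup E] [NormedSpace ℝ E]
    {ι : Type*} (x : ι → E) (l : Filter ι) (a : E) : Prop :=
  Tendsto (fun i => toWeakSpace ℝ E (x i)) l (𝓝 (toWeakSpace ℝ E a))

/-- Unbounded absolutely weak convergence: `|x i - a| ⊓ w` is weakly null for every `w ≥ 0`. -/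
def UawTendsto {E : Type*} [NormedAddCommGroup E] [NormedSpace ℝ E] [Lattice E]
    {ι : Type*} (x : ι → E) (l : Filter ι) (a : E) : Prop :=
  ∀ w : E, 0 ≤ w → WeakTendsto (fun i => |x i - a| ⊓ w) l 0

/-- A set whose closure in the weak topology is weakly compact. -/
def IsRelWeaklyCompact {E : Type*} [NormedAddCommGroup E] [NormedSpace ℝ E] (S : Set E) : Prop :=
  IsCompact (closure (toWeakSpace ℝ E '' S))

/-- A norm bounded set `S` such that every disjoint sequence in its solid hull is norm null. -/
def IsLWeaklyCompact {E : Type*} [NormedAddCommGroup E] [Lattice E] (S : Set E) : Prop :=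
  Bornology.IsBounded S ∧
    ∀ x : ℕ → E, (∀ n, x n ∈ LatticeOrderedAddCommGroup.solidClosure S) →
      (∀ m n, m ≠ n → |x m| ⊓ |x n| = 0) → Tendsto x atTop (𝓝 0)

/-- The positive Schur property: weakly null sequences of positive elements are norm null. -/
def PositiveSchurProperty (E : Type*) [NormedAddCommGroup E] [NormedSpace ℝ E] [Lattice E] :
    Prop :=
  ∀ x : ℕ → E, (∀ n, 0 ≤ x n) → WeakTendsto x atTop 0 → Tendsto x atTop (𝓝 0)

/-- The net `x` has a subnet `x ∘ φ` that is uaw-convergent to `a`. -/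
def HasSubnetUawTendsto {E : Type u} [NormedAddCommGroup E] [NormedSpace ℝ E] [Lattice E]
    {ι : Type u} [Preorder ι] (x : ι → E) (a : E) : Prop :=
  ∃ (κ : Type u) (_ : Preorder κ) (_ : IsDirected κ (· ≤ ·)) (_ : Nonempty κ) (φ : κ → ι),
    Tendsto φ atTop atTop ∧ UawTendsto (x ∘ φ) atTop a

/-- A norm bounded set in which every net has a subnet that is uaw-convergent to a point of the
set. Nets indexed by directed sets in the universe of `E` determine compactness. -/
def IsUawCompact {E : Type u} [NormedAddCommGroup E] [NormedSpace ℝ E] [Lattice E]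
    (A : Set E) : Prop :=
  Bornology.IsBounded A ∧
    ∀ (ι : Type u) [Preorder ι] [IsDirected ι (· ≤ ·)] [Nonempty ι] (x : ι → E),
      (∀ i, x i ∈ A) → ∃ a ∈ A, HasSubnetUawTendsto x a

/-- A norm bounded set in which every net has a subnet that is uaw-convergent in `E`. -/
def IsRelUawCompact {E : Type u} [NormedAddCommGroup E] [NormedSpace ℝ E] [Lattice E]
    (A : Set E) : Prop :=
  Bornology.IsBounded A ∧
    ∀ (ι : Type u) [Preorder ι] [IsDirected ι (· ≤ ·)] [Nonempty ι] (x : ι → E),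
      (∀ i, x i ∈ A) → ∃ a : E, HasSubnetUawTendsto x a

end BanachLattice

/-! The positive Schur property has two consequences. First, positive sequences with order bounded
partial sums are weakly null, hence norm null (`SumBoundedNull`, a sequential form of order
continuity of the norm). Second, disjoint positive sequences in the solid hull of a relatively
weakly compact set are weakly null (`weakTendsto_zero_of_disjoint`), hence norm null, so such a set
is L-weakly compact.

An L-weakly compact set has an almost order bounded solid hull: its elements lie in one order
interval up to small norm. There uaw convergence is norm convergence
(`SumBoundedNull.tendsto_of_uawTendsto`): the part of `|x i - a|` above a suitable `w` is uniformly
small, while `|x i - a| ⊓ w` is weakly null and order bounded, hence norm null by order continuity.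
This yields 3, 5 and 6.

Conversely, a positive weakly null sequence is uaw null, and together with 0 it forms a relatively
weakly compact and uaw-compact set, so 4, 5 or 6 returns the Schur property. From 2, singletons show
that order bounded disjoint sequences are norm null; a disjointification argument upgrades this to
`SumBoundedNull`, and the previous paragraph applies. -/

namespace BanachLattice

/-! ### Hahn–Banach and the weak topology. -/

section Functionals

/-- Hahn–Banach: a sublinear functional dominates a linear functional that agrees with it at a
given point. -/
theorem exists_linear_le_sublinear {F : Type*} [AddCommGroup F] [Module ℝ F] (N : F → ℝ)
    (N_hom : ∀ c : ℝ, 0 < c → ∀ x, N (c • x) = c * N x)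
    (N_add : ∀ x y, N (x + y) ≤ N x + N y) {a : F} (ha : a ≠ 0) :
    ∃ g : F →ₗ[ℝ] ℝ, g a = N a ∧ ∀ x, g x ≤ N x := by
  have h0 : N 0 = 0 := by
    have := N_hom 2 two_pos 0
    rw [smul_zero] at this
    linarith
  obtain ⟨g, hg, hgN⟩ := exists_extension_of_le_sublinear
    (LinearPMap.mkSpanSingleton (σ := RingHom.id ℝ) a (N a) ha) N N_hom N_add (by
      rintro ⟨x, hx⟩
      obtain ⟨c, rfl⟩ := Submodule.mem_span_singleton.1 hx
      have hval : LinearPMap.mkSpanSingleton (σ := RingHom.id ℝ) a (N a) ha ⟨c • a, hx⟩ = c * N a :=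
        LinearPMap.mkSpanSingleton'_apply (σ := RingHom.id ℝ) a (N a) _ c hx
      rw [hval]
      change c * N a ≤ N (c • a)
      rcases lt_trichotomy c 0 with hc | rfl | hc
      · have h1 := N_hom (-c) (by linarith) a
        have h2 := N_add (c • a) ((-c) • a)
        rw [← add_smul, add_neg_cancel, zero_smul, h0] at h2
        linarith
      · simp [h0]
      · rw [N_hom c hc])
  refine ⟨g, ?_, hgN⟩
  have := hg ⟨a, Submodule.mem_span_singleton_self a⟩
  rw [this]
  exact LinearPMap.mkSpanSingleton_apply (σ := RingHom.id ℝ) ℝ ℝ ha (N a)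

variable {E : Type*} [NormedAddCommGroup E] [NormedSpace ℝ E]

theorem weakTendsto_iff {ι : Type*} {x : ι → E} {l : Filter ι} {a : E} :
    WeakTendsto x l a ↔ ∀ f : E →L[ℝ] ℝ, Tendsto (fun i => f (x i)) l (𝓝 (f a)) :=
  WeakBilin.tendsto_iff_forall_eval_tendsto (topDualPairing ℝ E).flip
    (by
      intro a b hab
      by_contra hne
      obtain ⟨f, hf⟩ := SeparatingDual.exists_separating_of_ne (R := ℝ) hne
      exact hf (LinearMap.congr_fun hab f))

theorem continuous_eval_weakSpace (f : E →L[ℝ] ℝ) :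
    Continuous (fun x : WeakSpace ℝ E => f ((toWeakSpace ℝ E).symm x)) :=
  WeakBilin.eval_continuous (topDualPairing ℝ E).flip f

theorem WeakTendsto.comp {ι κ : Type*} {x : ι → E} {l : Filter ι} {a : E}
    (h : WeakTendsto x l a) {φ : κ → ι} {m : Filter κ} (hφ : Tendsto φ m l) :
    WeakTendsto (x ∘ φ) m a :=
  Filter.Tendsto.comp (g := fun i => toWeakSpace ℝ E (x i)) h hφ

theorem weakTendsto_of_tendsto {ι : Type*} {x : ι → E} {l : Filter ι} {a : E}
    (h : Tendsto x l (𝓝 a)) : WeakTendsto x l a :=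
  weakTendsto_iff.2 fun f => (f.continuous.tendsto a).comp h

/-- Each functional is bounded on a weakly compact set; uniform boundedness in the bidual does the
rest. -/
theorem isBounded_of_isRelWeaklyCompact {S : Set E} (hS : IsRelWeaklyCompact S) :
    Bornology.IsBounded S := by
  have key : ∃ C, ∀ y : S, ‖NormedSpace.inclusionInDoubleDual ℝ E (y : E)‖ ≤ C := by
    apply banach_steinhaus
    intro f
    obtain ⟨C, hC⟩ := (hS.image (continuous_eval_weakSpace f)).isBounded.exists_norm_le
    refine ⟨C, fun y => hC _ ⟨toWeakSpace ℝ E y, subset_closure ⟨y, y.2, rfl⟩, rfl⟩⟩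
  obtain ⟨C, hC⟩ := key
  refine (isBounded_iff_forall_norm_le).2 ⟨C, fun y hy => ?_⟩
  have h := hC ⟨y, hy⟩
  have : ‖NormedSpace.inclusionInDoubleDualLi ℝ (E := E) y‖ = ‖y‖ :=
    LinearIsometry.norm_map _ _
  rw [← this]
  exact h

theorem isRelWeaklyCompact_insert_range {x : ℕ → E} {a : E} (h : WeakTendsto x atTop a) :
    IsRelWeaklyCompact (insert a (Set.range x)) := by
  have hK := Filter.Tendsto.isCompact_insert_range h
  have : T2Space (WeakSpace ℝ E) := by
    refine (WeakBilin.isEmbedding (B := (topDualPairing ℝ E).flip) ?_).t2Space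
    intro a b hab
    by_contra hne
    obtain ⟨f, hf⟩ := SeparatingDual.exists_separating_of_ne (R := ℝ) hne
    exact hf (LinearMap.congr_fun hab f)
  refine hK.closure_of_subset ?_
  rintro _ ⟨y, hy, rfl⟩
  rcases hy with rfl | ⟨n, rfl⟩
  · exact Or.inl rfl
  · exact Or.inr ⟨n, rfl⟩

end Functionals

/-! ### Disjointness and positive parts in lattice-ordered groups and vector lattices. -/

section LatticeLemmas

variable {E : Type*} [AddCommGroup E] [Lattice E] [IsOrderedAddMonoid E]

theorem inf_add_le_add_inf {z a b : E} (hz : 0 ≤ z) (ha : 0 ≤ a) (hb : 0 ≤ b) :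
    z ⊓ (a + b) ≤ z ⊓ a + z ⊓ b := by
  rw [inf_add, add_inf, add_inf]
  refine le_inf (le_inf ?_ ?_) (le_inf ?_ ?_)
  · exact inf_le_left.trans (le_add_of_nonneg_left hz)
  · exact inf_le_left.trans (le_add_of_nonneg_right hb)
  · exact inf_le_left.trans (le_add_of_nonneg_left ha)
  · exact inf_le_right

theorem inf_add_eq_zero {z a b : E} (hz : 0 ≤ z) (ha : 0 ≤ a) (hb : 0 ≤ b)
    (hza : z ⊓ a = 0) (hzb : z ⊓ b = 0) : z ⊓ (a + b) = 0 := by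
  refine le_antisymm ?_ (le_inf hz (add_nonneg ha hb))
  have := inf_add_le_add_inf hz ha hb
  rwa [hza, hzb, add_zero] at this

theorem inf_sum_eq_zero {ι : Type*} {z : E} (hz : 0 ≤ z) (s : Finset ι) (a : ι → E)
    (ha : ∀ i ∈ s, 0 ≤ a i) (h : ∀ i ∈ s, z ⊓ a i = 0) : z ⊓ ∑ i ∈ s, a i = 0 := by
  classical
  induction s using Finset.induction_on with
  | empty => simpa using hz
  | insert i s hi ih =>
    rw [Finset.sum_insert hi]
    exact inf_add_eq_zero hz (ha i (Finset.mem_insert_self i s))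
      (Finset.sum_nonneg fun j hj => ha j (Finset.mem_insert_of_mem hj))
      (h i (Finset.mem_insert_self i s))
      (ih (fun j hj => ha j (Finset.mem_insert_of_mem hj))
        (fun j hj => h j (Finset.mem_insert_of_mem hj)))

theorem add_le_of_inf_eq_zero {a b c : E} (h : a ⊓ b = 0) (ha : a ≤ c) (hb : b ≤ c) :
    a + b ≤ c := by
  have := inf_add_sup a b
  rw [h, zero_add] at this
  rw [← this]
  exact sup_le ha hb

theorem sum_le_of_disjoint {c : E} (hc : 0 ≤ c) (z : ℕ → E) (hz : ∀ n, 0 ≤ z n)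
    (hzc : ∀ n, z n ≤ c) (hd : ∀ m n, m ≠ n → z m ⊓ z n = 0) (N : ℕ) :
    ∑ n ∈ Finset.range N, z n ≤ c := by
  induction N with
  | zero => simpa using hc
  | succ N ih =>
    rw [Finset.sum_range_succ, add_comm]
    refine add_le_of_inf_eq_zero ?_ (hzc N) ih
    exact inf_sum_eq_zero (hz N) _ _ (fun i _ => hz i)
      fun i hi => hd _ _ (Finset.mem_range.1 hi).ne'

omit [IsOrderedAddMonoid E] in
theorem inf_eq_zero_of_le {a b c d : E} (ha : 0 ≤ a) (hb : 0 ≤ b) (hac : a ≤ c) (hbd : b ≤ d)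
    (h : c ⊓ d = 0) : a ⊓ b = 0 :=
  le_antisymm (h ▸ inf_le_inf hac hbd) (le_inf ha hb)

theorem sub_posPart_eq_inf (a b : E) : a - (a - b)⁺ = a ⊓ b := (inf_eq_sub_posPart_sub a b).symm

theorem posPart_sub_le_left {a b : E} (ha : 0 ≤ a) (hb : 0 ≤ b) : (a - b)⁺ ≤ a :=
  sup_le (sub_le_self a hb) ha

theorem posPart_add_le (a b : E) : (a + b)⁺ ≤ a⁺ + b⁺ :=
  sup_le (add_le_add (le_posPart a) (le_posPart b)) (add_nonneg (posPart_nonneg a) (posPart_nonneg b))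

theorem abs_le_of_nonneg_le {a b : E} (ha : 0 ≤ a) (hab : a ≤ b) : |a| ≤ |b| := by
  rwa [abs_of_nonneg ha, abs_of_nonneg (ha.trans hab)]

end LatticeLemmas

section VectorLattice

variable {E : Type*} [AddCommGroup E] [Lattice E] [IsOrderedAddMonoid E] [Module ℝ E]
  [IsOrderedModule ℝ E]

omit [IsOrderedAddMonoid E] in
theorem smul_posPart {c : ℝ} (hc : 0 < c) (x : E) : (c • x)⁺ = c • x⁺ := by
  refine le_antisymm (sup_le (smul_le_smul_of_nonneg_left (le_posPart x) hc.le)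
    (smul_nonneg hc.le (posPart_nonneg x))) ?_
  have h : x⁺ ≤ c⁻¹ • (c • x)⁺ := by
    refine sup_le ?_ (smul_nonneg (inv_nonneg.2 hc.le) (posPart_nonneg _))
    calc x = c⁻¹ • (c • x) := by rw [smul_smul, inv_mul_cancel₀ hc.ne', one_smul]
      _ ≤ _ := smul_le_smul_of_nonneg_left (le_posPart _) (inv_nonneg.2 hc.le)
  calc c • x⁺ ≤ c • (c⁻¹ • (c • x)⁺) := smul_le_smul_of_nonneg_left h hc.le
    _ = _ := by rw [smul_smul, mul_inv_cancel₀ hc.ne', one_smul]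

/-- The second factor is `c⁻¹` times the negative part of `a - c • b`, whose positive part is the
first. This is the source of disjointness in the disjointification below. -/
theorem posPart_inf_posPart_eq_zero {c : ℝ} (hc : 1 ≤ c) (a b : E) :
    (a - c • b)⁺ ⊓ (b - c⁻¹ • a)⁺ = 0 := by
  have hc0 : 0 < c := by linarith
  have h1 : (b - c⁻¹ • a)⁺ = c⁻¹ • (a - c • b)⁻ := by
    rw [← posPart_neg, ← smul_posPart (inv_pos.2 hc0), neg_sub, smul_sub, smul_smul,
      inv_mul_cancel₀ hc0.ne', one_smul]
  refine inf_eq_zero_of_le (posPart_nonneg _) (posPart_nonneg _) le_rfl ?_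
    (posPart_inf_negPart_eq_zero (a - c • b))
  rw [h1]
  calc c⁻¹ • (a - c • b)⁻ ≤ (1 : ℝ) • (a - c • b)⁻ :=
        smul_le_smul_of_nonneg_right (inv_le_one_of_one_le₀ hc) (negPart_nonneg _)
    _ = _ := one_smul _ _

end VectorLattice

/-! ### Positive functionals and weak convergence of positive families. -/

section NormedLattice

variable {E : Type*} [NormedAddCommGroup E] [Lattice E] [IsOrderedAddMonoid E] [HasSolidNorm E]

theorem norm_le_norm_of_nonneg_of_le {a b : E} (ha : 0 ≤ a) (hab : a ≤ b) : ‖a‖ ≤ ‖b‖ :=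
  norm_le_norm_of_abs_le_abs (abs_le_of_nonneg_le ha hab)

theorem norm_posPart_le (a : E) : ‖a⁺‖ ≤ ‖a‖ := by
  refine norm_le_norm_of_abs_le_abs ?_
  rw [abs_of_nonneg (posPart_nonneg a)]
  exact sup_le (le_abs_self a) (abs_nonneg a)

theorem norm_posPart_sub_ge (a b : E) : ‖a⁺‖ - ‖b‖ ≤ ‖(a - b)⁺‖ := by
  have h : ‖a⁺‖ ≤ ‖(a - b)⁺ + b⁺‖ :=
    norm_le_norm_of_nonneg_of_le (posPart_nonneg a) (by simpa using posPart_add_le (a - b) b)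
  have h2 := norm_add_le (a - b)⁺ b⁺
  have h3 := norm_posPart_le b
  linarith

variable [NormedSpace ℝ E] [IsOrderedModule ℝ E]

omit [IsOrderedModule ℝ E] in
/-- A linear functional dominated by `c * ‖x⁺‖` is positive and bounded. -/
theorem exists_clm_of_le_norm_posPart (g : E →ₗ[ℝ] ℝ) {c : ℝ} (hc : 0 ≤ c)
    (h : ∀ x, g x ≤ c * ‖x⁺‖) :
    ∃ f : E →L[ℝ] ℝ, (∀ x, f x = g x) ∧ (∀ x, 0 ≤ x → 0 ≤ f x) ∧ ‖f‖ ≤ c := by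
  have hb : ∀ x, ‖g x‖ ≤ c * ‖x‖ := by
    intro x
    rw [Real.norm_eq_abs]
    refine abs_le'.2 ⟨(h x).trans (mul_le_mul_of_nonneg_left (norm_posPart_le x) hc), ?_⟩
    rw [← map_neg]
    refine (h (-x)).trans (mul_le_mul_of_nonneg_left ?_ hc)
    simpa using norm_posPart_le (-x)
  refine ⟨g.mkContinuous c hb, fun x => rfl, fun x hx => ?_, g.mkContinuous_norm_le hc hb⟩
  have h1 := h (-x)
  rw [posPart_eq_zero.2 (neg_nonpos.2 hx), norm_zero, mul_zero, map_neg] at h1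
  change 0 ≤ g x
  linarith

/-- Hahn–Banach with the sublinear map `‖x⁺‖` instead of `‖x‖`: domination by it forces positivity
as well as norm at most 1. -/
theorem exists_positive_clm_eq_norm {a : E} (ha : 0 ≤ a) :
    ∃ f : E →L[ℝ] ℝ, (∀ x, 0 ≤ x → 0 ≤ f x) ∧ ‖f‖ ≤ 1 ∧ f a = ‖a‖ := by
  rcases eq_or_ne a 0 with rfl | ha0
  · exact ⟨0, by simp, by simp, by simp⟩
  obtain ⟨g, hga, hg⟩ := exists_linear_le_sublinear (fun x : E => ‖x⁺‖)
    (fun c hc x => by simp only [smul_posPart hc, norm_smul, Real.norm_of_nonneg hc.le])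
    (fun x y => (norm_le_norm_of_nonneg_of_le (posPart_nonneg _) (posPart_add_le x y)).trans
      (norm_add_le _ _)) ha0
  obtain ⟨f, hf, hpos, hn⟩ := exists_clm_of_le_norm_posPart g zero_le_one (by simpa using hg)
  exact ⟨f, hpos, hn, by rw [hf, hga, posPart_of_nonneg ha]⟩

/-- Every bounded functional is a difference of positive bounded functionals. -/
theorem exists_positive_sub_positive (f : E →L[ℝ] ℝ) :
    ∃ g h : E →L[ℝ] ℝ, (∀ x, 0 ≤ x → 0 ≤ g x) ∧ (∀ x, 0 ≤ x → 0 ≤ h x) ∧ ∀ x, f x = g x - h x := by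
  -- On the antidiagonal, `(a, -a)` is sent to `f a`. An extension `H` dominated by `N` is positive
  -- on both axes, and its restrictions there are `g` and `h`, since `H (x, -x) = g x - h x`.
  let D : Submodule ℝ (E × E) := LinearMap.ker (LinearMap.fst ℝ E E + LinearMap.snd ℝ E E)
  let p : (E × E) →ₗ.[ℝ] ℝ := ⟨D, (f.toLinearMap ∘ₗ LinearMap.fst ℝ E E).domRestrict D⟩
  let N : E × E → ℝ := fun q => ‖f‖ * (‖q.1⁺‖ + ‖q.2⁺‖)
  obtain ⟨H, hH, hHN⟩ := exists_extension_of_le_sublinear p N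
    (fun c hc x => by
      simp only [N, Prod.smul_fst, Prod.smul_snd, smul_posPart hc, norm_smul,
        Real.norm_of_nonneg hc.le]
      ring)
    (fun x y => by
      have h1 : ‖(x.1 + y.1)⁺‖ ≤ ‖x.1⁺‖ + ‖y.1⁺‖ :=
        (norm_le_norm_of_nonneg_of_le (posPart_nonneg _) (posPart_add_le _ _)).trans
          (norm_add_le _ _)
      have h2 : ‖(x.2 + y.2)⁺‖ ≤ ‖x.2⁺‖ + ‖y.2⁺‖ :=
        (norm_le_norm_of_nonneg_of_le (posPart_nonneg _) (posPart_add_le _ _)).trans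
          (norm_add_le _ _)
      simp only [N, Prod.fst_add, Prod.snd_add, ← mul_add]
      exact mul_le_mul_of_nonneg_left (by linarith) (norm_nonneg f))
    (by
      rintro ⟨⟨a, b⟩, hab⟩
      have hb : a + b = 0 := hab
      obtain rfl : b = -a := (neg_eq_of_add_eq_zero_right hb).symm
      change f a ≤ ‖f‖ * (‖a⁺‖ + ‖(-a)⁺‖)
      refine (le_abs_self _).trans ((f.le_opNorm a).trans ?_)
      refine mul_le_mul_of_nonneg_left ?_ (norm_nonneg f)
      rw [posPart_neg]
      calc ‖a‖ = ‖a⁺ - a⁻‖ := by rw [posPart_sub_negPart]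
        _ ≤ _ := norm_sub_le _ _)
  obtain ⟨g, hg, hg0, -⟩ := exists_clm_of_le_norm_posPart (H ∘ₗ LinearMap.inl ℝ E E)
    (norm_nonneg f) (fun x => by simpa [N] using hHN (x, 0))
  obtain ⟨h, hh, hh0, -⟩ := exists_clm_of_le_norm_posPart (H ∘ₗ LinearMap.inr ℝ E E)
    (norm_nonneg f) (fun x => by simpa [N] using hHN (0, x))
  refine ⟨g, h, hg0, hh0, fun x => ?_⟩
  have hD : ((x, -x) : E × E) ∈ D := by simp [D]
  have h1 : H (x, -x) = f x := hH ⟨(x, -x), hD⟩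
  rw [hg, hh, ← h1]
  simp only [LinearMap.comp_apply, LinearMap.inl_apply, LinearMap.inr_apply]
  rw [← map_sub]
  simp

theorem weakTendsto_zero_iff_positive {ι : Type*} {x : ι → E} {l : Filter ι} :
    WeakTendsto x l 0 ↔
      ∀ f : E →L[ℝ] ℝ, (∀ x, 0 ≤ x → 0 ≤ f x) → Tendsto (fun i => f (x i)) l (𝓝 0) := by
  refine ⟨fun h f _ => by simpa using weakTendsto_iff.1 h f, fun h => weakTendsto_iff.2 fun f => ?_⟩
  obtain ⟨g, k, hg, hk, hf⟩ := exists_positive_sub_positive f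
  simpa [hf] using (h g hg).sub (h k hk)

omit [HasSolidNorm E] [IsOrderedModule ℝ E] in
theorem positive_clm_mono {f : E →L[ℝ] ℝ} (hf : ∀ x, 0 ≤ x → 0 ≤ f x) {a b : E} (h : a ≤ b) :
    f a ≤ f b := by
  have := hf (b - a) (sub_nonneg.2 h)
  rw [map_sub] at this
  linarith

theorem WeakTendsto.of_nonneg_of_le {ι : Type*} {x y : ι → E} {l : Filter ι}
    (hy : WeakTendsto y l 0) (hx : ∀ i, 0 ≤ x i) (hxy : ∀ i, x i ≤ y i) : WeakTendsto x l 0 :=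
  weakTendsto_zero_iff_positive.2 fun f hf =>
    squeeze_zero (fun i => hf _ (hx i)) (fun i => positive_clm_mono hf (hxy i))
      (weakTendsto_zero_iff_positive.1 hy f hf)

/-- Positive sequences whose partial sums are order bounded are weakly null. -/
theorem weakTendsto_zero_of_sum_le {d : ℕ → E} {w : E} (hd : ∀ n, 0 ≤ d n)
    (hw : ∀ N, ∑ n ∈ Finset.range N, d n ≤ w) : WeakTendsto d atTop 0 := by
  refine weakTendsto_zero_iff_positive.2 fun f hf => ?_
  refine (summable_of_sum_range_le (c := f w) (fun n => hf _ (hd n)) fun N => ?_).tendsto_atTop_zero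
  rw [← map_sum]
  exact positive_clm_mono hf (hw N)

end NormedLattice

/-! ### From disjoint sequences to order continuity of the norm. -/

section Disjointification

variable {E : Type*} [NormedAddCommGroup E] [NormedSpace ℝ E] [CompleteSpace E] [Lattice E]
  [IsOrderedAddMonoid E] [IsOrderedModule ℝ E] [HasSolidNorm E]

/-- If disjoint sequences below a bounded set `A` of positive elements are norm null, then `A` is
almost order bounded by sums of its elements. -/
theorem exists_mem_closure_norm_posPart_le {A : Set E} (hA0 : ∀ a ∈ A, 0 ≤ a)
    (hb : Bornology.IsBounded A)
    (hdisj : ∀ y : ℕ → E, (∀ n, 0 ≤ y n) → (∀ n, ∃ a ∈ A, y n ≤ a) →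
      (∀ m n, m ≠ n → y m ⊓ y n = 0) → Tendsto y atTop (𝓝 0)) {ε : ℝ} (hε : 0 < ε) :
    ∃ u ∈ AddSubmonoid.closure A, ∀ a ∈ A, ‖(a - u)⁺‖ ≤ ε := by
  by_contra! h
  choose! g hgA hg using h
  obtain ⟨R, hR⟩ := hb.exists_norm_le
  -- Here `s n` is the sum of the earlier `x k`, and `x n` is an element of `A` that exceeds `4 ^ n
  -- • s n` by more than `ε` in norm.
  let s : ℕ → E := fun n => Nat.rec 0 (fun k t => t + g ((4 ^ k : ℕ) • t)) n
  let x : ℕ → E := fun n => g ((4 ^ n : ℕ) • s n)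
  have hs_succ : ∀ n, s (n + 1) = s n + x n := fun n => rfl
  have hs : ∀ n, s n ∈ AddSubmonoid.closure A := by
    intro n
    induction n with
    | zero => exact zero_mem _
    | succ n ih =>
      rw [hs_succ]
      exact add_mem ih (AddSubmonoid.subset_closure (hgA _ (nsmul_mem ih _)))
  have hxA : ∀ n, x n ∈ A := fun n => hgA _ (nsmul_mem (hs n) _)
  have hx0 : ∀ n, 0 ≤ x n := fun n => hA0 _ (hxA n)
  have hxs : ∀ n, ε < ‖(x n - (4 ^ n : ℝ) • s n)⁺‖ := by
    intro n
    have := hg _ (nsmul_mem (hs n) (4 ^ n))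
    have e : (4 ^ n : ℕ) • s n = (4 ^ n : ℝ) • s n := by
      rw [← Nat.cast_smul_eq_nsmul ℝ, Nat.cast_pow, Nat.cast_ofNat]
    rw [← e]
    exact this
  have hs_mono : Monotone s := monotone_nat_of_le_succ fun n => by
    rw [hs_succ]; exact le_add_of_nonneg_right (hx0 n)
  have hs0 : ∀ n, 0 ≤ s n := fun n => hs_mono (Nat.zero_le n)
  have hx_le_s : ∀ {m n}, m < n → x m ≤ s n := fun {m n} hmn =>
    le_trans (by rw [hs_succ]; exact le_add_of_nonneg_left (hs0 m)) (hs_mono hmn)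
  have hsum : Summable fun n => ((2 : ℝ)⁻¹ ^ n) • x n := by
    refine Summable.of_norm_bounded (g := fun n => (2 : ℝ)⁻¹ ^ n * R)
      ((summable_geometric_of_lt_one (by norm_num) (by norm_num)).mul_right R) fun n => ?_
    rw [norm_smul, Real.norm_of_nonneg (by positivity)]
    exact mul_le_mul_of_nonneg_left (hR _ (hxA n)) (by positivity)
  set X := ∑' n, ((2 : ℝ)⁻¹ ^ n) • x n with hX
  have hxX : ∀ n, ((2 : ℝ)⁻¹ ^ n) • x n ≤ X := fun n =>
    hsum.le_tsum n fun j _ => smul_nonneg (by positivity) (hx0 j)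
  have hX0 : 0 ≤ X := le_trans (smul_nonneg (by positivity) (hx0 0)) (hxX 0)
  -- For `m < n`, subtracting `4 ^ n • s n` puts `y n` below `(x n - 4 ^ n • x m)⁺`. Subtracting
  -- `2⁻ᵐ • X` puts `y m` below `(x m - 4⁻ⁿ • x n)⁺`, because `4⁻ⁿ ≤ 2⁻ᵐ 2⁻ⁿ` and `2⁻ⁿ • x n ≤ X`.
  -- The two bounds are disjoint, and the correction by `X` costs a norm tending to 0.
  let y : ℕ → E := fun n => (x n - (4 ^ n : ℝ) • s n - ((2 : ℝ)⁻¹ ^ n) • X)⁺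
  have hy0 : ∀ n, 0 ≤ y n := fun n => posPart_nonneg _
  have hyx : ∀ n, y n ≤ x n := fun n => by
    refine sup_le ?_ (hx0 n)
    exact (sub_le_self _ (smul_nonneg (by positivity) hX0)).trans
      (sub_le_self _ (smul_nonneg (by positivity) (hs0 n)))
  have hlt : ∀ m n, m < n → y n ⊓ y m = 0 := by
    intro m n hmn
    refine inf_eq_zero_of_le (hy0 n) (hy0 m) ?_ ?_
      (posPart_inf_posPart_eq_zero (c := 4 ^ n) (one_le_pow₀ (by norm_num)) (x n) (x m))
    · refine posPart_mono ((sub_le_self _ (smul_nonneg (by positivity) hX0)).trans ?_)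
      exact sub_le_sub_left (smul_le_smul_of_nonneg_left (hx_le_s hmn) (by positivity)) _
    · refine posPart_mono (sub_le_sub ?_ ?_)
      · exact sub_le_self _ (smul_nonneg (by positivity) (hs0 m))
      · calc ((4 : ℝ) ^ n)⁻¹ • x n ≤ ((2 : ℝ)⁻¹ ^ m * (2 : ℝ)⁻¹ ^ n) • x n := by
              refine smul_le_smul_of_nonneg_right ?_ (hx0 n)
              rw [← pow_add, ← inv_pow, show (4 : ℝ)⁻¹ = 2⁻¹ ^ 2 by norm_num, ← pow_mul]
              exact pow_le_pow_of_le_one (by norm_num) (by norm_num) (by omega)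
          _ = (2 : ℝ)⁻¹ ^ m • ((2 : ℝ)⁻¹ ^ n • x n) := by rw [smul_smul]
          _ ≤ _ := smul_le_smul_of_nonneg_left (hxX n) (by positivity)
  have hy := hdisj y hy0 (fun n => ⟨x n, hxA n, hyx n⟩) (by
    intro m n hmn
    rcases lt_or_gt_of_ne hmn with h | h
    · rw [inf_comm]; exact hlt m n h
    · exact hlt n m h)
  have hlow : ∀ n, ε - (2 : ℝ)⁻¹ ^ n * ‖X‖ ≤ ‖y n‖ := by
    intro n
    have h1 := norm_posPart_sub_ge (x n - (4 ^ n : ℝ) • s n) (((2 : ℝ)⁻¹ ^ n) • X)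
    rw [norm_smul, Real.norm_of_nonneg (by positivity)] at h1
    have h2 := hxs n
    change _ ≤ ‖(x n - (4 ^ n : ℝ) • s n - ((2 : ℝ)⁻¹ ^ n) • X)⁺‖
    linarith
  have hlim : Tendsto (fun n => ε - (2 : ℝ)⁻¹ ^ n * ‖X‖) atTop (𝓝 (ε - 0 * ‖X‖)) :=
    ((tendsto_pow_atTop_nhds_zero_of_lt_one (by norm_num) (by norm_num)).mul_const _).const_sub _
  have := le_of_tendsto_of_tendsto' hlim hy.norm hlow
  simp at this
  linarith

/-- Positive sequences with order bounded partial sums are norm null; this expresses order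
continuity of the norm for sequences. -/
def SumBoundedNull (E : Type*) [NormedAddCommGroup E] [Lattice E] : Prop :=
  ∀ (d : ℕ → E) (w : E), (∀ n, 0 ≤ d n) → (∀ N, ∑ n ∈ Finset.range N, d n ≤ w) →
    Tendsto d atTop (𝓝 0)

theorem exists_subseq_le_norm {F : Type*} [NormedAddCommGroup F] {d : ℕ → F}
    (h : ¬ Tendsto d atTop (𝓝 0)) :
    ∃ ε > 0, ∃ φ : ℕ → ℕ, StrictMono φ ∧ ∀ n, ε ≤ ‖d (φ n)‖ := by
  rw [Metric.tendsto_atTop] at h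
  push Not at h
  obtain ⟨ε, hε, h⟩ := h
  obtain ⟨φ, hφ, hd⟩ := extraction_of_frequently_atTop (P := fun n => ε ≤ ‖d n‖)
    (frequently_atTop.2 fun a => by simpa using h a)
  exact ⟨ε, hε, φ, hφ, hd⟩

/-- In an order interval in which disjoint sequences are norm null there is no seminormalized
sequence of bounded overlap. -/
theorem false_of_bounded_overlap {w : E}
    (hdisj : ∀ y : ℕ → E, (∀ n, 0 ≤ y n) → (∀ n, y n ≤ w) →
      (∀ m n, m ≠ n → y m ⊓ y n = 0) → Tendsto y atTop (𝓝 0)) (k : ℕ) :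
    ∀ (d : ℕ → E) (ε : ℝ), 0 < ε → (∀ n, 0 ≤ d n) → (∀ n, d n ≤ w) → (∀ n, ε ≤ ‖d n‖) →
      (∀ (F : Finset ℕ) (z : E), F.card = k + 1 → 0 ≤ z → (∀ i ∈ F, z ≤ d i) → z = 0) →
      False := by
  induction k with
  | zero =>
    intro d ε hε h0 _ hd hF
    have h1 := hF {0} (d 0) (by simp) (h0 0) (by simp)
    have h2 := hd 0
    rw [h1, norm_zero] at h2
    linarith
  | succ k ih =>
    intro d ε hε h0 hw hd hF
    have hw0 : 0 ≤ w := (h0 0).trans (hw 0)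
    obtain ⟨u, hu, hud⟩ := exists_mem_closure_norm_posPart_le (A := Set.range d)
      (by rintro _ ⟨n, rfl⟩; exact h0 n)
      (isBounded_iff_forall_norm_le.2 ⟨‖w‖, by
        rintro _ ⟨n, rfl⟩; exact norm_le_norm_of_nonneg_of_le (h0 n) (hw n)⟩)
      (fun y hy hyA hyd => hdisj y hy (fun n => by
        obtain ⟨_, ⟨i, rfl⟩, hi⟩ := hyA n; exact hi.trans (hw i)) hyd) (half_pos hε)
    -- If `d n` is asymptotically disjoint from every `d i`, then `d n ⊓ u` is norm null for the
    -- finite sum `u`, which contradicts `hud`. Otherwise, meeting a subsequence with one fixed `d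
    -- i` lowers the overlap bound by one.
    by_cases hall : ∀ i, Tendsto (fun n => d n ⊓ d i) atTop (𝓝 0)
    · have hu' : 0 ≤ u ∧ Tendsto (fun n => d n ⊓ u) atTop (𝓝 0) := by
        clear hud
        induction hu using AddSubmonoid.closure_induction with
        | mem x hx => obtain ⟨i, rfl⟩ := hx; exact ⟨h0 i, hall i⟩
        | zero =>
          refine ⟨le_rfl, tendsto_const_nhds.congr fun n => ?_⟩
          rw [inf_eq_right.2 (h0 n)]
        | add a b _ _ ha hb =>
          refine ⟨add_nonneg ha.1 hb.1, squeeze_zero_norm (fun n => ?_)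
            (by simpa using (ha.2.add hb.2).norm)⟩
          exact norm_le_norm_of_nonneg_of_le (le_inf (h0 n) (add_nonneg ha.1 hb.1))
            (inf_add_le_add_inf (h0 n) ha.1 hb.1)
      have hlow : ∀ n, ε / 2 ≤ ‖d n ⊓ u‖ := by
        intro n
        have h1 : d n = (d n - u)⁺ + d n ⊓ u := by rw [← sub_posPart_eq_inf]; abel
        have h2 := hd n
        rw [h1] at h2
        have h3 := norm_add_le (d n - u)⁺ (d n ⊓ u)
        have h4 := hud _ ⟨n, rfl⟩
        linarith
      have := ge_of_tendsto' hu'.2.norm hlow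
      rw [norm_zero] at this
      linarith
    · push Not at hall
      obtain ⟨i, hi⟩ := hall
      obtain ⟨δ, hδ, φ, hφ, hle⟩ := exists_subseq_le_norm hi
      -- The shift by `i + 1` makes every index exceed `i`, so that adjoining `i` to the index set
      -- really adds an element.
      have hψ : StrictMono fun n => φ (n + (i + 1)) := fun a b hab => hφ (by omega)
      have hne : ∀ n, φ (n + (i + 1)) ≠ i := fun n => by
        have := hφ.id_le (n + (i + 1))
        simp only [id] at this
        omega
      refine ih (fun n => d (φ (n + (i + 1))) ⊓ d i) δ hδ (fun n => le_inf (h0 _) (h0 _))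
        (fun n => inf_le_right.trans (hw i)) (fun n => hle _) fun F z hFc hz hzF => ?_
      refine hF (insert i (F.map ⟨_, hψ.injective⟩)) z ?_ hz ?_
      · rw [Finset.card_insert_of_notMem, Finset.card_map, hFc]
        simp only [Finset.mem_map, Function.Embedding.coeFn_mk, not_exists, not_and]
        exact fun n _ => hne n
      · intro j hj
        rcases Finset.mem_insert.1 hj with rfl | hj
        · obtain ⟨m, hm⟩ : F.Nonempty := Finset.card_pos.1 (by omega)
          exact (hzF m hm).trans inf_le_right
        · obtain ⟨m, hm, rfl⟩ := Finset.mem_map.1 hj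
          exact (hzF m hm).trans inf_le_left

/-- Cut a seminormalized subsequence at the level `t = w / C`. The excesses `(d - t)⁺` keep norm at
least `ε / 2`, yet no `C + 1` of them overlap, since `C + 1` copies of `t` exceed `w` by `t`. -/
theorem tendsto_zero_of_sum_le {w : E}
    (hdisj : ∀ y : ℕ → E, (∀ n, 0 ≤ y n) → (∀ n, y n ≤ w) →
      (∀ m n, m ≠ n → y m ⊓ y n = 0) → Tendsto y atTop (𝓝 0))
    (d : ℕ → E) (hd0 : ∀ n, 0 ≤ d n) (hdw : ∀ F : Finset ℕ, ∑ n ∈ F, d n ≤ w) :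
    Tendsto d atTop (𝓝 0) := by
  by_contra hd
  obtain ⟨ε, hε, φ, hφ, hle⟩ := exists_subseq_le_norm hd
  have hw0 : 0 ≤ w := by simpa using hdw ∅
  obtain ⟨C, hC⟩ := exists_nat_gt (2 * ‖w‖ / ε)
  have hCpos : (0 : ℝ) < C := lt_of_le_of_lt (by positivity) hC
  set t : E := (C : ℝ)⁻¹ • w with ht
  have ht0 : 0 ≤ t := smul_nonneg (by positivity) hw0
  have hCt : C • t = w := by
    rw [ht, ← Nat.cast_smul_eq_nsmul ℝ, smul_smul, mul_inv_cancel₀ hCpos.ne', one_smul]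
  have htn : ‖t‖ ≤ ε / 2 := by
    rw [ht, norm_smul, Real.norm_of_nonneg (by positivity), inv_mul_le_iff₀ hCpos]
    rw [div_lt_iff₀ hε] at hC
    linarith
  have hle_w : ∀ n, d n ≤ w := fun n => by simpa using hdw {n}
  refine false_of_bounded_overlap hdisj C (fun n => (d (φ n) - t)⁺) (ε / 2) (half_pos hε)
    (fun n => posPart_nonneg _) (fun n => (posPart_sub_le_left (hd0 _) ht0).trans (hle_w _))
    (fun n => ?_) (fun F z hF hz hzF => ?_)
  · have h1 := norm_posPart_sub_ge (d (φ n)) t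
    rw [posPart_of_nonneg (hd0 _)] at h1
    have h2 := hle n
    linarith
  -- A common lower bound `z` of the excesses is disjoint from every `(d (φ i) - t)⁻`. These sum to
  -- at least `(C + 1) • t - w = t`, so `z` is disjoint from `t`, hence from `w = C • t`; as `z ≤
  -- w`, it vanishes.
  · have h1 : z ⊓ ∑ i ∈ F, (d (φ i) - t)⁻ = 0 :=
      inf_sum_eq_zero hz F _ (fun i _ => negPart_nonneg _) fun i hi =>
        inf_eq_zero_of_le hz (negPart_nonneg _) (hzF i hi) le_rfl (posPart_inf_negPart_eq_zero _)
    have h2 : t ≤ ∑ i ∈ F, (d (φ i) - t)⁻ := by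
      calc t = (C + 1) • t - w := by rw [succ_nsmul, hCt]; abel
        _ ≤ (C + 1) • t - ∑ i ∈ F, d (φ i) := by
          refine sub_le_sub_left ?_ _
          simpa using hdw (F.map ⟨φ, hφ.injective⟩)
        _ = ∑ i ∈ F, (t - d (φ i)) := by rw [Finset.sum_sub_distrib, Finset.sum_const, hF]
        _ ≤ _ := Finset.sum_le_sum fun i _ => by
          rw [← neg_sub]; exact neg_le_negPart _
    have h3 : z ⊓ t = 0 := inf_eq_zero_of_le hz ht0 le_rfl h2 h1
    have h4 : z ⊓ w = 0 := by
      rw [← hCt]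
      simpa using inf_sum_eq_zero hz (Finset.range C) (fun _ => t) (fun _ _ => ht0) (fun _ _ => h3)
    obtain ⟨m, hm⟩ : F.Nonempty := Finset.card_pos.1 (by omega)
    rwa [inf_eq_left.2 ((hzF m hm).trans ((posPart_sub_le_left (hd0 _) ht0).trans (hle_w _)))] at h4

theorem sumBoundedNull_of_disjoint
    (hdisj : ∀ (w : E) (y : ℕ → E), (∀ n, 0 ≤ y n) → (∀ n, y n ≤ w) →
      (∀ m n, m ≠ n → y m ⊓ y n = 0) → Tendsto y atTop (𝓝 0)) : SumBoundedNull E := by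
  intro d w hd0 hdw
  refine tendsto_zero_of_sum_le (hdisj w) d hd0 fun F => ?_
  obtain ⟨N, hN⟩ := F.exists_nat_subset_range
  exact (Finset.sum_le_sum_of_subset_of_nonneg hN fun i _ _ => hd0 i).trans (hdw N)

end Disjointification

/-! ### Order continuity: weak versus norm convergence under order bounds. -/

section OrderContinuity

variable {E : Type*} [NormedAddCommGroup E] [Lattice E] [IsOrderedAddMonoid E]

/-- If the sequence were not Cauchy, increments of norm at least `ε` along a subsequence would
telescope below an order bound. -/
theorem SumBoundedNull.exists_tendsto_of_monotone [CompleteSpace E] (hE : SumBoundedNull E)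
    {t : ℕ → E} {w : E} (ht : Monotone t) (hw : ∀ n, t n ≤ w) : ∃ a, Tendsto t atTop (𝓝 a) := by
  refine cauchySeq_tendsto_of_complete ?_
  rw [Metric.cauchySeq_iff']
  by_contra! h
  obtain ⟨ε, hε, h⟩ := h
  choose f hf hd using h
  let φ : ℕ → ℕ := fun n => f^[n] 0
  have hφ : ∀ n, φ (n + 1) = f (φ n) := fun n => Function.iterate_succ_apply' f n 0
  have hnull := hE (fun n => t (φ (n + 1)) - t (φ n)) (w - t (φ 0))
    (fun n => sub_nonneg.2 (ht (by rw [hφ]; exact hf _)))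
    (fun N => by
      rw [Finset.sum_range_sub (fun n => t (φ n))]
      exact sub_le_sub_right (hw _) _)
  have := ge_of_tendsto' hnull.norm (b := ε) fun n => by
    rw [hφ, ← dist_eq_norm]
    exact hd _
  rw [norm_zero] at this
  linarith

variable [NormedSpace ℝ E] [CompleteSpace E] [IsOrderedModule ℝ E] [HasSolidNorm E]

/-- If the norm is order continuous for sequences, order bounded positive weakly null families are
norm null. -/
theorem SumBoundedNull.tendsto_zero_of_weakTendsto (hE : SumBoundedNull E) {ι : Type*} {v : ι → E}
    {l : Filter ι} {w : E} (hv : WeakTendsto v l 0) (hv0 : ∀ i, 0 ≤ v i) (hvw : ∀ i, v i ≤ w) :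
    Tendsto v l (𝓝 0) := by
  by_contra hnot
  obtain ⟨ε, hε, hfreq⟩ : ∃ ε > 0, ∃ᶠ i in l, ε ≤ ‖v i‖ := by
    rw [Metric.tendsto_nhds] at hnot
    push Not at hnot
    simpa using hnot
  choose F hF0 hF1 hFv using fun i => exists_positive_clm_eq_norm (hv0 i)
  -- Each new term is almost annihilated by the norming functionals of all earlier ones. The second
  -- component is a counter whose strict growth makes these errors summable.
  obtain ⟨p, hpP, hpr⟩ := exists_seq_of_forall_finset_exists
    (fun p : ι × ℕ => ε ≤ ‖v p.1‖)
    (fun p q => F p.1 (v q.1) ≤ ε / 4 * (1 / 2 : ℝ) ^ q.2 ∧ p.2 < q.2) (by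
      intro s _
      have hev : ∀ᶠ i in l, ∀ p ∈ s, F p.1 (v i) ≤ ε / 4 * (1 / 2 : ℝ) ^ (s.sup Prod.snd + 1) := by
        rw [eventually_all_finset]
        intro p _
        exact ((weakTendsto_zero_iff_positive.1 hv _ (hF0 p.1)).eventually_lt_const
          (by positivity)).mono fun i hi => hi.le
      obtain ⟨i, hi, hi'⟩ := (hfreq.and_eventually hev).exists
      exact ⟨(i, s.sup Prod.snd + 1), hi, fun p hp =>
        ⟨hi' p hp, Nat.lt_succ_of_le (Finset.le_sup (f := Prod.snd) hp)⟩⟩)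
  have hk : StrictMono fun n => (p n).2 := fun m n hmn => (hpr m n hmn).2
  set z : ℕ → E := fun n => v (p n).1 with hz
  set G : ℕ → E →L[ℝ] ℝ := fun n => F (p n).1 with hG
  have hz0 : ∀ n, 0 ≤ z n := fun n => hv0 _
  have hw0 : 0 ≤ w := (hz0 0).trans (hvw _)
  have hGz : ∀ m n, m < n → G m (z n) ≤ ε / 4 * (1 / 2 : ℝ) ^ n := fun m n hmn =>
    (hpr m n hmn).1.trans (mul_le_mul_of_nonneg_left
      (pow_le_pow_of_le_one (by norm_num) (by norm_num) (hk.id_le n)) (by positivity))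
  -- The limits `a n` are truncated tail sums: they decrease and converge in norm. But `G n` is at
  -- least `ε` on `a n ≥ z n` and at most `ε / 2` on `a (n + 1)`, so consecutive limits stay apart.
  let t : ℕ → ℕ → E := fun n N => (∑ m ∈ Finset.Ico n N, z m) ⊓ w
  have ht : ∀ n, ∃ a, Tendsto (t n) atTop (𝓝 a) := fun n =>
    hE.exists_tendsto_of_monotone (w := w)
      (fun M N hMN => inf_le_inf_right _ (Finset.sum_le_sum_of_subset_of_nonneg
        (Finset.Ico_subset_Ico_right hMN) fun i _ _ => hz0 i)) (fun N => inf_le_right)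
  choose a ha using ht
  have hza : ∀ n, z n ≤ a n := fun n =>
    ge_of_tendsto (ha n) (eventually_atTop.2 ⟨n + 1, fun N hN => le_inf
      (Finset.single_le_sum (f := z) (fun i _ => hz0 i) (Finset.mem_Ico.2 ⟨le_rfl, hN⟩)) (hvw _)⟩)
  have hanti : Antitone a := antitone_nat_of_succ_le fun n =>
    le_of_tendsto_of_tendsto' (ha (n + 1)) (ha n) fun N =>
      inf_le_inf_right _ (Finset.sum_le_sum_of_subset_of_nonneg
        (Finset.Ico_subset_Ico_left (Nat.le_succ n)) fun i _ _ => hz0 i)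
  obtain ⟨b, hb⟩ := hE.exists_tendsto_of_monotone (t := fun n => w - a n) (w := w)
    (fun m n hmn => sub_le_sub_left (hanti hmn) _)
    (fun n => sub_le_self _ ((hz0 n).trans (hza n)))
  have hdiff : Tendsto (fun n => ‖a n - a (n + 1)‖) atTop (𝓝 0) := by
    have := ((hb.comp (tendsto_add_atTop_nat 1)).sub hb).norm
    simpa using this
  have hGa : ∀ n, G n (a (n + 1)) ≤ ε / 2 := fun n => by
    refine le_of_tendsto' (((G n).continuous.tendsto _).comp (ha (n + 1))) fun N => ?_
    refine (positive_clm_mono (hF0 _) inf_le_left).trans ?_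
    rw [map_sum]
    calc ∑ m ∈ Finset.Ico (n + 1) N, G n (z m)
        ≤ ∑ m ∈ Finset.Ico (n + 1) N, ε / 4 * (1 / 2 : ℝ) ^ m :=
          Finset.sum_le_sum fun m hm => hGz n m (Finset.mem_Ico.1 hm).1
      _ ≤ ∑ m ∈ Finset.range N, ε / 4 * (1 / 2 : ℝ) ^ m :=
          Finset.sum_le_sum_of_subset_of_nonneg
            (fun m hm => Finset.mem_range.2 (Finset.mem_Ico.1 hm).2) fun _ _ _ => by positivity
      _ = ε / 4 * ∑ m ∈ Finset.range N, (1 / 2 : ℝ) ^ m := by rw [Finset.mul_sum]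
      _ ≤ ε / 4 * 2 := mul_le_mul_of_nonneg_left (sum_geometric_two_le N) (by positivity)
      _ = ε / 2 := by ring
  have hfinal : ∀ n, ε / 2 ≤ ‖a n - a (n + 1)‖ := fun n => by
    have h1 : ε ≤ G n (z n) := (hpP n).trans (hFv _).ge
    have h2 : G n (z n) ≤ G n (a n) := positive_clm_mono (hF0 _) (hza n)
    have h3 : G n (a n - a (n + 1)) ≤ ‖a n - a (n + 1)‖ := by
      refine (le_abs_self _).trans (((G n).le_opNorm _).trans ?_)
      exact mul_le_of_le_one_left (norm_nonneg _) (hF1 _)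
    rw [map_sub] at h3
    have h4 := hGa n
    linarith
  have := ge_of_tendsto' hdiff hfinal
  linarith

/-- A set contained in an order interval up to arbitrarily small norm. -/
def AlmostOrderBounded {E : Type*} [NormedAddCommGroup E] [Lattice E] (A : Set E) : Prop :=
  ∀ ε > 0, ∃ u : E, 0 ≤ u ∧ ∀ x ∈ A, ‖(|x| - u)⁺‖ ≤ ε

theorem IsLWeaklyCompact.almostOrderBounded {S : Set E} (hS : IsLWeaklyCompact S) :
    AlmostOrderBounded (LatticeOrderedAddCommGroup.solidClosure S) := by
  intro ε hε
  obtain ⟨R, hR⟩ := hS.1.exists_norm_le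
  obtain ⟨u, hu, hle⟩ := exists_mem_closure_norm_posPart_le (A := (fun y => |y|) '' S)
    (by rintro _ ⟨y, _, rfl⟩; exact abs_nonneg y)
    (isBounded_iff_forall_norm_le.2 ⟨R, by
      rintro _ ⟨y, hy, rfl⟩; exact (norm_abs_eq_norm y).le.trans (hR y hy)⟩)
    (fun y hy0 hyA hyd => hS.2 y (fun n => by
      obtain ⟨_, ⟨s, hs, rfl⟩, hle⟩ := hyA n
      exact ⟨s, hs, by rwa [abs_of_nonneg (hy0 n)]⟩)
      (fun m n hmn => by rw [abs_of_nonneg (hy0 m), abs_of_nonneg (hy0 n)]; exact hyd m n hmn)) hε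
  refine ⟨u, ?_, ?_⟩
  · clear hle
    induction hu using AddSubmonoid.closure_induction with
    | mem x hx => obtain ⟨y, _, rfl⟩ := hx; exact abs_nonneg y
    | zero => exact le_rfl
    | add a b _ _ ha hb => exact add_nonneg ha hb
  · rintro x ⟨y, hy, hxy⟩
    exact (norm_le_norm_of_nonneg_of_le (posPart_nonneg _)
      (posPart_mono (sub_le_sub_right hxy u))).trans (hle _ ⟨y, hy, rfl⟩)

theorem SumBoundedNull.tendsto_of_uawTendsto (hE : SumBoundedNull E) {A : Set E}
    (hA : AlmostOrderBounded A) {ι : Type*} {x : ι → E} {l : Filter ι} {a : E}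
    (hx : ∀ i, x i ∈ A) (h : UawTendsto x l a) : Tendsto x l (𝓝 a) := by
  rw [Metric.tendsto_nhds]
  intro ε hε
  obtain ⟨u, hu0, hu⟩ := hA (ε / 2) (half_pos hε)
  have hw : 0 ≤ u + |a| := add_nonneg hu0 (abs_nonneg a)
  have hnull := hE.tendsto_zero_of_weakTendsto (h _ hw) (fun i => le_inf (abs_nonneg _) hw)
    (fun i => inf_le_right)
  filter_upwards [hnull.norm.eventually_lt_const (u := ε / 2) (by simpa using half_pos hε)]
    with i hi
  rw [dist_eq_norm, ← norm_abs_eq_norm]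
  have h1 : |x i - a| = (|x i - a| - (u + |a|))⁺ + |x i - a| ⊓ (u + |a|) := by
    rw [← sub_posPart_eq_inf]; abel
  have h2 : ‖(|x i - a| - (u + |a|))⁺‖ ≤ ε / 2 := by
    refine (norm_le_norm_of_nonneg_of_le (posPart_nonneg _) (posPart_mono ?_)).trans (hu _ (hx i))
    have h3 : |x i - a| ≤ |x i| + |a| := by simpa [sub_eq_add_neg] using abs_add_le (x i) (-a)
    rw [sub_le_iff_le_add]
    calc |x i - a| ≤ |x i| + |a| := h3
      _ = |x i| - u + (u + |a|) := by abel
  rw [h1]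
  have h4 := norm_add_le (|x i - a| - (u + |a|))⁺ (|x i - a| ⊓ (u + |a|))
  linarith

end OrderContinuity

/-! ### Disjoint sequences in solid hulls of relatively weakly compact sets. -/

section Schur

/-- Along a relatively weakly compact set, an absolutely summable sequence of functionals has
uniformly small coordinates; this is the Schur property of `ℓ¹`. -/
theorem false_of_le_abs_apply {E : Type*} [NormedAddCommGroup E] [NormedSpace ℝ E] {S : Set E}
    (hS : IsRelWeaklyCompact S) (g : ℕ → E →L[ℝ] ℝ) {C : ℝ}
    (hC : ∀ y N, ∑ n ∈ Finset.range N, |g n y| ≤ C * ‖y‖) (y : ℕ → E) (hy : ∀ n, y n ∈ S)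
    {ε : ℝ} (hε : 0 < ε) (h : ∀ n, ε ≤ |g n (y n)|) : False := by
  have hsum : ∀ y, Summable fun n => |g n y| := fun y =>
    summable_of_sum_range_le (fun n => abs_nonneg _) (hC y)
  have hle : ∀ (s : ℕ → Bool) y n, ‖if s n then g n y else 0‖ ≤ |g n y| := fun s y n => by
    split_ifs
    · exact le_rfl
    · simp
  have hsum' : ∀ (s : ℕ → Bool) y, Summable fun n => if s n then g n y else 0 := fun s y =>
    Summable.of_norm_bounded (hsum y) (hle s y)
  let G : (ℕ → Bool) → E →L[ℝ] ℝ := fun s => LinearMap.mkContinuous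
    { toFun := fun y => ∑' n, if s n then g n y else 0
      map_add' := fun a b => by
        rw [← (hsum' s a).tsum_add (hsum' s b)]
        refine tsum_congr fun n => ?_
        split_ifs <;> simp
      map_smul' := fun c a => by
        rw [RingHom.id_apply, smul_eq_mul, ← tsum_mul_left]
        refine tsum_congr fun n => ?_
        split_ifs <;> simp } C (fun y => by
      refine (tsum_of_norm_bounded (hsum y).hasSum (hle s y)).trans ?_
      exact (hsum y).tsum_le_of_sum_range_le (hC y))
  have hG : ∀ s y, G s y = ∑' n, if s n then g n y else 0 := fun s y => rfl
  let Φ : WeakSpace ℝ E → ℕ → ℝ := fun p n => g n ((toWeakSpace ℝ E).symm p)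
  have hΦ : Continuous Φ := continuous_pi fun n => continuous_eval_weakSpace (g n)
  have hyK : ∀ n, toWeakSpace ℝ E (y n) ∈ closure (toWeakSpace ℝ E '' S) := fun n =>
    subset_closure ⟨y n, hy n, rfl⟩
  -- The image in `ℕ → ℝ` is metrizable, which gives a subsequence converging in every coordinate `g
  -- n`. Any weak ultrafilter limit has the coordinates of `b`, and `G s` depends only on them.
  obtain ⟨_, ⟨p, _, rfl⟩, φ, hφ, hlim⟩ := (hS.image hΦ).tendsto_subseq
    (x := fun n => Φ (toWeakSpace ℝ E (y n))) fun n => ⟨_, hyK n, rfl⟩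
  set b := (toWeakSpace ℝ E).symm p with hb
  have hcoord : ∀ n, Tendsto (fun j => g n (y (φ j))) atTop (𝓝 (g n b)) := fun n =>
    ((continuous_apply n).tendsto _).comp hlim
  have hGlim : ∀ s, Tendsto (fun j => G s (y (φ j))) atTop (𝓝 (G s b)) := by
    intro s
    rw [tendsto_iff_ultrafilter]
    intro U hU
    obtain ⟨q, _, hq⟩ := hS.ultrafilter_le_nhds (U.map fun j => toWeakSpace ℝ E (y (φ j)))
      (le_principal_iff.2 (by
        rw [Ultrafilter.mem_coe, Ultrafilter.mem_map]
        exact univ_mem' fun j => hyK (φ j)))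
    have hq' : Tendsto (fun j => toWeakSpace ℝ E (y (φ j))) U (𝓝 q) := hq
    have hf : ∀ f : E →L[ℝ] ℝ,
        Tendsto (fun j => f (y (φ j))) U (𝓝 (f ((toWeakSpace ℝ E).symm q))) := fun f =>
      ((continuous_eval_weakSpace f).tendsto q).comp hq'
    have heq : G s b = G s ((toWeakSpace ℝ E).symm q) := by
      rw [hG, hG]
      refine tsum_congr fun n => ?_
      rw [tendsto_nhds_unique ((hcoord n).mono_left hU) (hf (g n))]
    rw [heq]
    exact hf (G s)
  -- Baire category on `ℕ → Bool` makes the convergence uniform near some `s`. A neighbourhood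
  -- constrains finitely many coordinates only; flipping any other coordinate `n` isolates `g n` as
  -- a difference of two values of `G`.
  let D : ℕ → Set (ℕ → Bool) := fun J => {s | ∀ j, J ≤ j → |G s (y (φ j) - b)| ≤ ε / 8}
  have hDc : ∀ J, IsClosed (D J) := by
    intro J
    have : D J = ⋂ j, ⋂ _ : J ≤ j, {s | |G s (y (φ j) - b)| ≤ ε / 8} := by
      ext s; simp [D]
    rw [this]
    refine isClosed_iInter fun j => isClosed_iInter fun _ => isClosed_le ?_ continuous_const
    refine continuous_abs.comp ?_
    refine continuous_tsum (u := fun n => |g n (y (φ j) - b)|) (fun n => ?_) (hsum _)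
      (fun n s => hle s _ n)
    exact (continuous_of_discreteTopology
      (f := fun c : Bool => if c then g n (y (φ j) - b) else 0)).comp (continuous_apply n)
  have hDu : ⋃ J, D J = Set.univ := by
    refine Set.eq_univ_of_forall fun s => Set.mem_iUnion.2 ?_
    have h1 : Tendsto (fun j => |G s (y (φ j) - b)|) atTop (𝓝 0) := by
      have := ((hGlim s).sub_const (G s b)).abs
      simpa using this
    obtain ⟨J, hJ⟩ := eventually_atTop.1 (h1.eventually_lt_const (u := ε / 8) (by positivity))
    exact ⟨J, fun j hj => (hJ j hj).le⟩
  obtain ⟨J, s, hs⟩ := nonempty_interior_of_iUnion_of_closed hDc hDu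
  obtain ⟨I, V, hV, hIV⟩ := isOpen_pi_iff.1 isOpen_interior s hs
  have hupd : ∀ n ∉ I, ∀ c, Function.update s n c ∈ D J := fun n hn c =>
    interior_subset (hIV fun i hi => by
      rw [Function.update_of_ne (by rintro rfl; exact hn hi)]
      exact (hV i hi).2)
  have hsmall : ∀ n ∉ I, ∀ j, J ≤ j → |g n (y (φ j) - b)| ≤ ε / 4 := by
    intro n hn j hj
    set e := y (φ j) - b
    have h1 := hupd n hn true j hj
    have h2 := hupd n hn false j hj
    have h3 : G (Function.update s n true) e - G (Function.update s n false) e = g n e := by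
      rw [hG, hG, ← (hsum' _ e).tsum_sub (hsum' _ e), tsum_eq_single n]
      · simp
      · intro m hm
        simp [Function.update_of_ne hm]
    rw [← h3]
    have h4 := abs_sub (G (Function.update s n true) e) (G (Function.update s n false) e)
    linarith
  have hev1 : ∀ᶠ j in atTop, φ j ∉ I := by
    have := hφ.tendsto_atTop.eventually_gt_atTop (I.sup id)
    filter_upwards [this] with j hj hjI
    exact absurd (Finset.le_sup (f := id) hjI) (not_le.2 hj)
  have hev2 : ∀ᶠ j in atTop, |g (φ j) b| < ε / 4 :=
    ((hsum b).tendsto_atTop_zero.comp hφ.tendsto_atTop).eventually_lt_const (by positivity)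
  obtain ⟨j, h1, h2, h3⟩ := (hev1.and (hev2.and (eventually_ge_atTop J))).exists
  have h4 := hsmall _ h1 j h3
  have h5 := h (φ j)
  have h6 : g (φ j) (y (φ j)) = g (φ j) (y (φ j) - b) + g (φ j) b := by rw [map_sub]; ring
  rw [h6] at h5
  have h7 := abs_add_le (g (φ j) (y (φ j) - b)) (g (φ j) b)
  linarith

variable {E : Type*} [NormedAddCommGroup E] [NormedSpace ℝ E] [Lattice E]
  [IsOrderedAddMonoid E] [IsOrderedModule ℝ E]

theorem inf_eq_zero_of_le_smul {a b z z' : E} {k l : ℝ} (ha : 0 ≤ a) (hb : 0 ≤ b)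
    (hz : 0 ≤ z) (hz' : 0 ≤ z') (hza : z ≤ k • a) (hzb : z' ≤ l • b) (h : a ⊓ b = 0) :
    z ⊓ z' = 0 := by
  have hnat : ∀ {c d : E}, 0 ≤ c → 0 ≤ d → c ⊓ d = 0 → ∀ n : ℕ, c ⊓ n • d = 0 :=
    fun {c d} hc hd hcd n => by
      simpa using inf_sum_eq_zero hc (Finset.range n) (fun _ => d) (fun _ _ => hd) (fun _ _ => hcd)
  have hceil : ∀ {c d : E} {r : ℝ}, 0 ≤ d → c ≤ r • d → c ≤ ⌈r⌉₊ • d := fun {c d r} hd hc => by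
    rw [← Nat.cast_smul_eq_nsmul ℝ]
    exact hc.trans (smul_le_smul_of_nonneg_right (Nat.le_ceil r) hd)
  refine inf_eq_zero_of_le hz hz' (hceil ha hza) (hceil hb hzb) ?_
  refine hnat (nsmul_nonneg ha _) hb ?_ _
  rw [inf_comm]
  exact hnat hb ha (by rwa [inf_comm]) _

omit [IsOrderedAddMonoid E] in
theorem abs_smul_le {c : ℝ} (hc : 0 ≤ c) (x : E) : |c • x| ≤ c • |x| := by
  refine abs_le'.2 ⟨smul_le_smul_of_nonneg_left (le_abs_self x) hc, ?_⟩
  rw [← smul_neg]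
  exact smul_le_smul_of_nonneg_left (neg_le_abs x) hc

/-- The values of `f` on positive elements below `|y|` in the ideal generated by `a`. -/
def idealValues (f : E →L[ℝ] ℝ) (a y : E) : Set ℝ :=
  {r | ∃ z : E, 0 ≤ z ∧ z ≤ |y| ∧ (∃ k : ℝ, z ≤ k • a) ∧ f z = r}

omit [IsOrderedModule ℝ E] in
theorem idealValues_le {f : E →L[ℝ] ℝ} (hf : ∀ x, 0 ≤ x → 0 ≤ f x) {a y : E} {r : ℝ}
    (hr : r ∈ idealValues f a y) : r ≤ f |y| := by
  obtain ⟨z, _, hz, _, rfl⟩ := hr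
  exact positive_clm_mono hf hz

omit [IsOrderedModule ℝ E] in
theorem bddAbove_idealValues {f : E →L[ℝ] ℝ} (hf : ∀ x, 0 ≤ x → 0 ≤ f x) (a y : E) :
    BddAbove (idealValues f a y) :=
  ⟨f |y|, fun _ hr => idealValues_le hf hr⟩

omit [IsOrderedModule ℝ E] in
theorem idealValues_nonempty (f : E →L[ℝ] ℝ) (a y : E) : (idealValues f a y).Nonempty :=
  ⟨f 0, 0, le_rfl, abs_nonneg y, ⟨0, by simp⟩, rfl⟩

theorem sSup_idealValues_smul {f : E →L[ℝ] ℝ} (hf : ∀ x, 0 ≤ x → 0 ≤ f x) (a : E) (c : ℝ)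
    (hc : 0 < c) (y : E) : sSup (idealValues f a (c • y)) = c * sSup (idealValues f a y) := by
  have key : ∀ (c : ℝ), 0 < c → ∀ y,
      sSup (idealValues f a (c • y)) ≤ c * sSup (idealValues f a y) := by
    intro c hc y
    refine csSup_le (idealValues_nonempty _ _ _) ?_
    rintro _ ⟨z, hz0, hz, ⟨k, hk⟩, rfl⟩
    have h1 : f (c⁻¹ • z) ≤ sSup (idealValues f a y) := by
      refine le_csSup (bddAbove_idealValues hf a y)
        ⟨c⁻¹ • z, smul_nonneg (by positivity) hz0, ?_, ⟨c⁻¹ * k, ?_⟩, rfl⟩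
      · calc c⁻¹ • z ≤ c⁻¹ • (c • |y|) :=
              smul_le_smul_of_nonneg_left (hz.trans (abs_smul_le hc.le y)) (by positivity)
          _ = |y| := by rw [smul_smul, inv_mul_cancel₀ hc.ne', one_smul]
      · rw [mul_smul]
        exact smul_le_smul_of_nonneg_left hk (by positivity)
    rw [map_smul, smul_eq_mul, inv_mul_le_iff₀ hc] at h1
    exact h1
  refine le_antisymm (key c hc y) ?_
  have h2 := key c⁻¹ (inv_pos.2 hc) (c • y)
  rw [smul_smul, inv_mul_cancel₀ hc.ne', one_smul] at h2
  rwa [← le_inv_mul_iff₀ hc]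

omit [IsOrderedModule ℝ E] in
-- Riesz decomposition: `z` splits into `z ⊓ |y|` and `(z - |y|)⁺`, both still in the ideal.
theorem sSup_idealValues_add {f : E →L[ℝ] ℝ} (hf : ∀ x, 0 ≤ x → 0 ≤ f x) (a y y' : E) :
    sSup (idealValues f a (y + y')) ≤ sSup (idealValues f a y) + sSup (idealValues f a y') := by
  refine csSup_le (idealValues_nonempty _ _ _) ?_
  rintro _ ⟨z, hz0, hz, ⟨k, hk⟩, rfl⟩
  have hz1 : f (z ⊓ |y|) ≤ sSup (idealValues f a y) :=
    le_csSup (bddAbove_idealValues hf a y)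
      ⟨_, le_inf hz0 (abs_nonneg y), inf_le_right, ⟨k, inf_le_left.trans hk⟩, rfl⟩
  have hz2 : f (z - |y|)⁺ ≤ sSup (idealValues f a y') :=
    le_csSup (bddAbove_idealValues hf a y')
      ⟨_, posPart_nonneg _, sup_le (by
        rw [sub_le_iff_le_add']
        exact hz.trans (abs_add_le y y')) (abs_nonneg y'),
        ⟨k, (posPart_sub_le_left hz0 (abs_nonneg y)).trans hk⟩, rfl⟩
  have : z = z ⊓ |y| + (z - |y|)⁺ := by rw [← sub_posPart_eq_inf]; abel
  rw [this, map_add]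
  exact add_le_add hz1 hz2

/-- Near-optimal elements for different `n` lie in disjoint ideals, so their sum still lies below
`|y|`. -/
theorem sum_sSup_idealValues_le {f : E →L[ℝ] ℝ} (hf : ∀ x, 0 ≤ x → 0 ≤ f x) {x : ℕ → E}
    (hx : ∀ n, 0 ≤ x n) (hd : ∀ m n, m ≠ n → x m ⊓ x n = 0) (y : E) (N : ℕ) :
    ∑ n ∈ Finset.range N, sSup (idealValues f (x n) y) ≤ f |y| := by
  refine le_of_forall_pos_le_add fun δ hδ => ?_
  have hN : (0 : ℝ) < N + 1 := by positivity
  have hex : ∀ n, ∃ z : E, (0 ≤ z ∧ z ≤ |y| ∧ ∃ k : ℝ, z ≤ k • x n) ∧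
      sSup (idealValues f (x n) y) - δ / (N + 1) ≤ f z := fun n => by
    obtain ⟨_, ⟨z, hz0, hz, hk, rfl⟩, hlt⟩ := exists_lt_of_lt_csSup
      (idealValues_nonempty f (x n) y)
      (sub_lt_self (sSup (idealValues f (x n) y)) (div_pos hδ hN))
    exact ⟨z, ⟨hz0, hz, hk⟩, hlt.le⟩
  choose z hz hzf using hex
  have hsum : ∑ n ∈ Finset.range N, z n ≤ |y| :=
    sum_le_of_disjoint (abs_nonneg y) z (fun n => (hz n).1) (fun n => (hz n).2.1)
      (fun m n hmn => by
        obtain ⟨k, hk⟩ := (hz m).2.2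
        obtain ⟨l, hl⟩ := (hz n).2.2
        exact inf_eq_zero_of_le_smul (hx m) (hx n) (hz m).1 (hz n).1 hk hl (hd m n hmn)) N
  have h1 : ∑ n ∈ Finset.range N, (sSup (idealValues f (x n) y) - δ / (N + 1)) ≤ f |y| := by
    refine (Finset.sum_le_sum fun n _ => hzf n).trans ?_
    rw [← map_sum]
    exact positive_clm_mono hf hsum
  rw [Finset.sum_sub_distrib, Finset.sum_const, Finset.card_range, nsmul_eq_mul] at h1
  have h2 : (N : ℝ) * (δ / (N + 1)) ≤ δ := by
    rw [mul_div_assoc', div_le_iff₀ hN]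
    nlinarith
  linarith

variable [HasSolidNorm E]

/-- Disjoint positive sequences in the solid hull of a relatively weakly compact set are weakly
null. -/
theorem weakTendsto_zero_of_disjoint {S : Set E} (hS : IsRelWeaklyCompact S) {x : ℕ → E}
    (hx : ∀ n, 0 ≤ x n) (hxS : ∀ n, x n ∈ LatticeOrderedAddCommGroup.solidClosure S)
    (hd : ∀ m n, m ≠ n → x m ⊓ x n = 0) : WeakTendsto x atTop 0 := by
  refine weakTendsto_zero_iff_positive.2 fun f hf => ?_
  by_contra hnot
  obtain ⟨ε, hε, φ, hφ, hle⟩ := exists_subseq_le_norm hnot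
  choose y hyS hxy using hxS
  have hne : ∀ n, y (φ n) ≠ 0 := fun n h0 => by
    have h1 := hxy (φ n)
    rw [h0, abs_zero, abs_of_nonneg (hx _)] at h1
    have h2 := hle n
    rw [le_antisymm h1 (hx _), map_zero, norm_zero] at h2
    linarith
  -- Each `g n` attains at `y (φ n)` the supremum of `f` over the ideal of `x (φ n)` below `|y (φ
  -- n)|`. That supremum is at least `f (x (φ n)) ≥ ε`, while the sums of `|g n y|` are at most `f
  -- |y|`.
  choose g hg hgle using fun n => exists_linear_le_sublinear
    (fun y => sSup (idealValues f (x (φ n)) y)) (sSup_idealValues_smul hf (x (φ n)))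
    (sSup_idealValues_add hf (x (φ n))) (hne n)
  have hgabs : ∀ n y, |g n y| ≤ sSup (idealValues f (x (φ n)) y) := fun n y => by
    refine abs_le'.2 ⟨hgle n y, ?_⟩
    rw [← map_neg]
    refine (hgle n (-y)).trans (le_of_eq ?_)
    simp only [idealValues, abs_neg]
  have hfabs : ∀ y, f |y| ≤ ‖f‖ * ‖y‖ := fun y =>
    (le_abs_self _).trans ((f.le_opNorm _).trans (by rw [norm_abs_eq_norm]))
  refine false_of_le_abs_apply hS (C := ‖f‖) (fun n => (g n).mkContinuous ‖f‖ fun y =>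
    ((hgabs n y).trans (csSup_le (idealValues_nonempty _ _ _) fun r hr =>
      idealValues_le hf hr)).trans (hfabs y)) (fun y N => ?_) (fun n => y (φ n))
    (fun n => hyS _) hε fun n => ?_
  · refine le_trans ?_ (hfabs y)
    refine le_trans (Finset.sum_le_sum fun n _ => hgabs n y) ?_
    exact sum_sSup_idealValues_le hf (fun n => hx (φ n))
      (fun m n hmn => hd _ _ (hφ.injective.ne hmn)) y N
  · change ε ≤ |g n (y (φ n))|
    rw [hg]
    refine le_trans ?_ (le_abs_self _)
    have h1 := hle n
    rw [Real.norm_of_nonneg (hf _ (hx _))] at h1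
    refine h1.trans (le_csSup (bddAbove_idealValues hf _ _) ⟨x (φ n), hx _, ?_, ⟨1, by simp⟩, rfl⟩)
    have h2 := hxy (φ n)
    rwa [abs_of_nonneg (hx _)] at h2

theorem PositiveSchurProperty.isLWeaklyCompact (hE : PositiveSchurProperty E) {S : Set E}
    (hS : IsRelWeaklyCompact S) : IsLWeaklyCompact S := by
  refine ⟨isBounded_of_isRelWeaklyCompact hS, fun x hxS hd => ?_⟩
  have h := hE (fun n => |x n|) (fun n => abs_nonneg _)
    (weakTendsto_zero_of_disjoint hS (fun n => abs_nonneg _) (fun n => by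
      obtain ⟨y, hy, hxy⟩ := hxS n
      exact ⟨y, hy, by rwa [abs_abs]⟩) hd)
  rw [tendsto_zero_iff_norm_tendsto_zero] at h ⊢
  simpa [norm_abs_eq_norm] using h

theorem PositiveSchurProperty.sumBoundedNull (hE : PositiveSchurProperty E) : SumBoundedNull E :=
  fun d _ hd hw => hE d hd (weakTendsto_zero_of_sum_le hd hw)

end Schur

/-! ### Uaw-compact sets and the converse implications. -/

section UawCompact

theorem subset_solidClosure {E : Type*} [AddCommGroup E] [Lattice E] {S : Set E} :
    S ⊆ LatticeOrderedAddCommGroup.solidClosure S := fun x hx => ⟨x, hx, le_rfl⟩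

/-- The order isomorphism between a lift of `ℕ` to a higher universe and `ℕ`. -/
def orderIsoULiftNat : ULift.{u} ℕ ≃o ℕ := ⟨Equiv.ulift, Iff.rfl⟩

theorem uawTendsto_of_weakTendsto {E : Type*} [NormedAddCommGroup E] [NormedSpace ℝ E] [Lattice E]
    [IsOrderedAddMonoid E] [IsOrderedModule ℝ E] [HasSolidNorm E] {ι : Type*} {x : ι → E}
    {l : Filter ι} (hx : ∀ i, 0 ≤ x i) (h : WeakTendsto x l 0) : UawTendsto x l 0 := fun w hw =>
  h.of_nonneg_of_le (fun _ => le_inf (abs_nonneg _) hw) fun i => by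
    rw [sub_zero, abs_of_nonneg (hx i)]
    exact inf_le_left

variable {E : Type u} [NormedAddCommGroup E] [NormedSpace ℝ E] [Lattice E]

theorem IsUawCompact.isRelUawCompact {A : Set E} (hA : IsUawCompact A) : IsRelUawCompact A :=
  ⟨hA.1, fun ι _ _ _ x hx => let ⟨a, _, ha⟩ := hA.2 ι x hx; ⟨a, ha⟩⟩

omit [NormedSpace ℝ E] in
theorem AlmostOrderBounded.mono {A B : Set E} (hB : AlmostOrderBounded B) (hAB : A ⊆ B) :
    AlmostOrderBounded A := fun ε hε =>
  let ⟨u, hu, h⟩ := hB ε hε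
  ⟨u, hu, fun x hx => h x (hAB hx)⟩

variable [IsOrderedAddMonoid E]

/-- A bounded uaw-convergent sequence together with its limit is uaw-compact. -/
theorem isUawCompact_insert_range {x : ℕ → E} {a : E}
    (hb : Bornology.IsBounded (insert a (Set.range x))) (hx : UawTendsto x atTop a) :
    IsUawCompact (insert a (Set.range x)) := by
  refine ⟨hb, fun ι _ _ _ y hy => ?_⟩
  -- Either the net takes some value frequently, which gives a constant subnet, or it eventually
  -- avoids any finite set of terms and follows the tail of `x` to `a`.
  by_cases h : ∃ b ∈ insert a (Set.range x), ∃ᶠ i in atTop, y i = b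
  · obtain ⟨b, hbA, hfreq⟩ := h
    rw [frequently_atTop] at hfreq
    refine ⟨b, hbA, {i // y i = b}, inferInstance, ⟨fun i j => ?_⟩, ?_, Subtype.val, ?_, ?_⟩
    · obtain ⟨k, hik, hjk⟩ := directed_of (· ≤ ·) i.1 j.1
      obtain ⟨m, hkm, hm⟩ := hfreq k
      exact ⟨⟨m, hm⟩, hik.trans hkm, hjk.trans hkm⟩
    · obtain ⟨m, -, hm⟩ := hfreq (Classical.arbitrary ι)
      exact ⟨⟨m, hm⟩⟩
    · refine tendsto_atTop.2 fun i => ?_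
      obtain ⟨m, him, hm⟩ := hfreq i
      filter_upwards [eventually_ge_atTop (⟨m, hm⟩ : {i // y i = b})] with k hk
      exact him.trans hk
    · intro w hw
      refine weakTendsto_of_tendsto (tendsto_const_nhds.congr fun k => ?_)
      rw [Function.comp_apply, k.2, sub_self, abs_zero, inf_eq_left.2 hw]
  · push Not at h
    refine ⟨a, Or.inl rfl, ι, inferInstance, inferInstance, inferInstance, id, tendsto_id,
      fun w hw U hU => ?_⟩
    obtain ⟨N, hN⟩ := mem_atTop_sets.1 (hx w hw hU)
    have h1 : ∀ᶠ i in atTop, ∀ k ∈ Finset.range N, y i ≠ x k := by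
      rw [eventually_all_finset]
      exact fun k _ => h (x k) (Or.inr ⟨k, rfl⟩)
    rw [mem_map]
    filter_upwards [h1, h a (Or.inl rfl)] with i hi hia
    rcases hy i with h2 | ⟨n, hn⟩
    · exact absurd h2 hia
    · have hNn : N ≤ n := by
        by_contra hlt
        exact hi n (Finset.mem_range.2 (not_le.1 hlt)) hn.symm
      have := hN n hNn
      simp only [Set.mem_preimage, Function.comp_apply, id, ← hn] at this ⊢
      exact this

variable [IsOrderedModule ℝ E] [HasSolidNorm E]

/-- If relatively weakly compact, uaw-compact sets have norm compact closure, then `E` has the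
positive Schur property. -/
theorem positiveSchurProperty_of_isCompact
    (h : ∀ A : Set E, IsRelWeaklyCompact A → IsUawCompact A → IsCompact (closure A)) :
    PositiveSchurProperty E := by
  intro x hx0 hx
  have hS := isRelWeaklyCompact_insert_range hx
  have hK := h _ hS (isUawCompact_insert_range (isBounded_of_isRelWeaklyCompact hS)
    (uawTendsto_of_weakTendsto hx0 hx))
  refine tendsto_of_subseq_tendsto fun ns hns => ?_
  obtain ⟨a, -, φ, hφ, ha⟩ := hK.tendsto_subseq (x := x ∘ ns)
    fun n => subset_closure (Or.inr ⟨ns n, rfl⟩)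
  have ha0 : a = 0 := by
    by_contra hne
    obtain ⟨f, hf⟩ := SeparatingDual.exists_ne_zero (R := ℝ) hne
    have h1 := weakTendsto_iff.1 ((hx.comp hns).comp hφ.tendsto_atTop) f
    rw [map_zero] at h1
    exact hf (tendsto_nhds_unique (((f.continuous.tendsto a).comp ha)) h1)
  exact ⟨φ, ha0 ▸ ha⟩

variable [CompleteSpace E]

theorem SumBoundedNull.exists_subseq_tendsto (hE : SumBoundedNull E) {A : Set E}
    (hA : AlmostOrderBounded A) {x : ℕ → E} (hx : ∀ n, x n ∈ A) {a : E}
    (h : HasSubnetUawTendsto (fun i : ULift.{u} ℕ => x i.down) a) :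
    ∃ φ : ℕ → ℕ, StrictMono φ ∧ Tendsto (x ∘ φ) atTop (𝓝 a) := by
  obtain ⟨κ, _, _, _, φ, hφ, hu⟩ := h
  have hlim := hE.tendsto_of_uawTendsto hA (fun k => hx (φ k).down) hu
  have hdown : Tendsto (fun k => (φ k).down) atTop atTop :=
    orderIsoULiftNat.tendsto_atTop.comp hφ
  have hcl : MapClusterPt a atTop x := hlim.mapClusterPt.of_comp hdown
  exact hcl.tendsto_subseq

theorem SumBoundedNull.isCompact (hE : SumBoundedNull E) {A : Set E} (hA : AlmostOrderBounded A)
    (h : IsUawCompact A) : IsCompact A := by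
  refine IsSeqCompact.isCompact fun x hx => ?_
  obtain ⟨a, ha, hsub⟩ := h.2 (ULift.{u} ℕ) (fun i => x i.down) fun i => hx _
  exact ⟨a, ha, hE.exists_subseq_tendsto hA hx hsub⟩

theorem SumBoundedNull.isCompact_closure (hE : SumBoundedNull E) {A : Set E}
    (hA : AlmostOrderBounded A) (h : IsRelUawCompact A) : IsCompact (closure A) := by
  refine IsSeqCompact.isCompact fun z hz => ?_
  choose x hx hd using fun n : ℕ =>
    Metric.mem_closure_iff.1 (hz n) (1 / ((n : ℝ) + 1)) Nat.one_div_pos_of_nat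
  obtain ⟨a, hsub⟩ := h.2 (ULift.{u} ℕ) (fun i => x i.down) fun i => hx _
  obtain ⟨φ, hφ, ha⟩ := hE.exists_subseq_tendsto hA hx hsub
  refine ⟨a, mem_closure_of_tendsto ha (Eventually.of_forall fun n => hx _), φ, hφ, ?_⟩
  refine ha.congr_dist ?_
  refine squeeze_zero (fun _ => dist_nonneg) (fun n => ?_)
    (tendsto_one_div_add_atTop_nhds_zero_nat.comp hφ.tendsto_atTop)
  rw [dist_comm]
  exact (hd (φ n)).le

theorem positiveSchurProperty_of_isLWeaklyCompact
    (h : ∀ S : Set E, IsRelWeaklyCompact S → IsLWeaklyCompact S) : PositiveSchurProperty E := by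
  -- L-weak compactness of `{w}`, presented as a constant sequence with its limit, controls the
  -- disjoint sequences in `[0, w]`.
  have hE : SumBoundedNull E := sumBoundedNull_of_disjoint fun w y hy hyw hd => by
    have hw := h _ (isRelWeaklyCompact_insert_range
      (weakTendsto_of_tendsto (tendsto_const_nhds (x := w) (f := atTop (α := ℕ)))))
    refine hw.2 y (fun n => ⟨w, Or.inl rfl, abs_le_of_nonneg_le (hy n) (hyw n)⟩)
      fun m n hmn => ?_
    rw [abs_of_nonneg (hy m), abs_of_nonneg (hy n)]
    exact hd m n hmn
  intro x hx0 hx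
  exact hE.tendsto_of_uawTendsto (h _ (isRelWeaklyCompact_insert_range hx)).almostOrderBounded
    (fun n => BanachLattice.subset_solidClosure (Or.inr ⟨n, rfl⟩))
    (uawTendsto_of_weakTendsto hx0 hx)

end UawCompact

end BanachLattice

/-! ### The equivalences. -/

theorem corollary3p19 (E : Type u) [NormedAddCommGroup E] [NormedSpace ℝ E]
    [CompleteSpace E] [Lattice E] [IsOrderedAddMonoid E] [IsOrderedModule ℝ E] [HasSolidNorm E] :
    List.TFAE [
      BanachLattice.PositiveSchurProperty E,
      ∀ S : Set E, BanachLattice.IsRelWeaklyCompact S → BanachLattice.IsLWeaklyCompact S,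
      ∀ S : Set E, BanachLattice.IsRelWeaklyCompact S →
        ∀ (ι : Type v) [Preorder ι] [IsDirected ι (· ≤ ·)] [Nonempty ι] (x : ι → E),
          (∀ i, x i ∈ LatticeOrderedAddCommGroup.solidClosure S) →
          BanachLattice.UawTendsto x atTop 0 → Tendsto x atTop (𝓝 0),
      ∀ S : Set E, BanachLattice.IsRelWeaklyCompact S →
        ∀ x : ℕ → E, (∀ n, x n ∈ LatticeOrderedAddCommGroup.solidClosure S) →
          BanachLattice.UawTendsto x atTop 0 → Tendsto x atTop (𝓝 0),
      ∀ S : Set E, BanachLattice.IsRelWeaklyCompact S →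
        ∀ A : Set E, A ⊆ LatticeOrderedAddCommGroup.solidClosure S →
          BanachLattice.IsUawCompact A → IsCompact A,
      ∀ S : Set E, BanachLattice.IsRelWeaklyCompact S →
        ∀ A : Set E, A ⊆ LatticeOrderedAddCommGroup.solidClosure S →
          BanachLattice.IsRelUawCompact A → IsCompact (closure A)] := by
  tfae_have 1 → 2 := fun h S hS => h.isLWeaklyCompact hS
  tfae_have 2 → 1 := BanachLattice.positiveSchurProperty_of_isLWeaklyCompact
  tfae_have 1 → 3 := fun h S hS ι _ _ _ x hx hu =>
    h.sumBoundedNull.tendsto_of_uawTendsto (h.isLWeaklyCompact hS).almostOrderBounded hx hu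
  tfae_have 3 → 4 := fun h S hS x hx hu => by
    have hdown : Tendsto (ULift.down : ULift.{v} ℕ → ℕ) atTop atTop :=
      BanachLattice.orderIsoULiftNat.tendsto_atTop
    have hup : Tendsto (ULift.up : ℕ → ULift.{v} ℕ) atTop atTop :=
      BanachLattice.orderIsoULiftNat.symm.tendsto_atTop
    exact (h S hS (ULift.{v} ℕ) (fun i => x i.down) (fun i => hx _)
      fun w hw => (hu w hw).comp hdown).comp hup
  tfae_have 4 → 1 := fun h x hx0 hx =>
    h _ (BanachLattice.isRelWeaklyCompact_insert_range hx) x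
      (fun n => BanachLattice.subset_solidClosure (Or.inr ⟨n, rfl⟩))
      (BanachLattice.uawTendsto_of_weakTendsto hx0 hx)
  tfae_have 1 → 5 := fun h S hS A hA hu =>
    h.sumBoundedNull.isCompact ((h.isLWeaklyCompact hS).almostOrderBounded.mono hA) hu
  tfae_have 5 → 1 := fun h => BanachLattice.positiveSchurProperty_of_isCompact fun A hA hu =>
    (h A hA A BanachLattice.subset_solidClosure hu).closure
  tfae_have 1 → 6 := fun h S hS A hA hu =>
    h.sumBoundedNull.isCompact_closure ((h.isLWeaklyCompact hS).almostOrderBounded.mono hA) hu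
  tfae_have 6 → 1 := fun h => BanachLattice.positiveSchurProperty_of_isCompact fun A hA hu =>
    h A hA A BanachLattice.subset_solidClosure hu.isRelUawCompact
  tfae_finish
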